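/- In the unbiased non-bipartite (odd-cycle) Avoider–Enforcer game on the edge set of the complete graph $K_n$, Avoider and Enforcer alternately claim one previously unclaimed edge of $K_n$ each, Avoider going first, until all edges are claimed; Enforcer wins as soon as the graph of the edges claimed by Avoider is non-bipartite (equivalently, contains an odd cycle). Let $\tau_E(\mathcal{NC}^2_n)$ be the smallest integer $t$ such that Enforcer has a strategy that makes Avoider's graph non-bipartite within the first $t$ moves of Avoider, against every play of Avoider ($\tau_E=\infty$ if there is no such $t$). Then $$\tau_E(\mathcal{NC}^2_n)=\frac{n^2}{8}+\Theta(n),$$ that is, there are constants $c,C>0$ such that $\frac{n^2}{8}+cn\le\tau_E(\mathcal{NC}^2_n)\le\frac{n^2}{8}+Cn$ for all sufficiently large $n$. More precisely: 1. for every $n\ge 5$, Enforcer has a strategy that makes Avoider's graph non-bipartite within the first $\frac{n^2}{8}+\frac n2+1$ moves; 2. for every even $n$, Avoider has a strategy that keeps his graph bipartite for at least $\frac{n^2}{8}+\frac{n-2}{12}$ rounds, i.e. there is an integer $t\ge\frac{n^2}{8}+\frac{n-2}{12}$ such that after $t$ rounds (or when the board is full, if that happens earlier) Avoider's graph is bipartite,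 whatever Enforcer does. -/

import Mathlib

namespace AvoiderEnforcer

/-- A strategy of either player in a game whose board is `V`: to every history of the game (the list
of all moves of both players so far, in order of play) which leaves some element unclaimed, it
assigns an unclaimed element, the one to be claimed next. -/
def Strategy (V : Type) : Type :=
  (h : List V) → (∃ v, v ∉ h) → {v : V // v ∉ h}

open Classical in
/-- The history after `m` single moves when Avoider plays by `α` and Enforcer by `σ`. Avoider moves
first and the players alternate, one element per turn; the play stops when the board is full. -/
noncomputable def play {V : Type} (α σ : Strategy V) : ℕ → List V
  | 0 => []
  | m + 1 =>
    if hv : ∃ v, v ∉ play α σ m then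
      play α σ m ++
        [if Even (play α σ m).length then (α (play α σ m) hv).1 else (σ (play α σ m) hv).1]
    else play α σ m

/-- The elements claimed by Avoider in a history: those at the positions `0, 2, 4, …`. -/
def avoiderSet {V : Type} (h : List V) : Set V :=
  {v | ∃ i : ℕ, h[2 * i]? = some v}

/-- Avoider has completely claimed some losing set (hyperedge of `F`) within the first `t` rounds
(a round is a move of Avoider followed by a move of Enforcer). -/
def AvoiderLosesWithin {V : Type} (F : Set (Set V)) (α σ : Strategy V) (t : ℕ) : Prop :=
  ∃ L ∈ F, L ⊆ avoiderSet (play α σ (2 * t))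

/-- Enforcer has a strategy to win the game `F` within `t` moves. -/
def EnforcerWinsWithin {V : Type} (F : Set (Set V)) (t : ℕ) : Prop :=
  ∃ σ : Strategy V, ∀ α : Strategy V, AvoiderLosesWithin F α σ t

/-- Avoider has a strategy to avoid claiming a losing set during the first `t` rounds. -/
def AvoiderSurvives {V : Type} (F : Set (Set V)) (t : ℕ) : Prop :=
  ∃ α : Strategy V, ∀ σ : Strategy V, ¬ AvoiderLosesWithin F α σ t

/-- The minimum move number: the least `t` such that Enforcer has a strategy to win within `t`
moves, and `⊤` if there is no such `t`. -/
noncomputable def tauE {V : Type} (F : Set (Set V)) : ℕ∞ :=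
  ⨅ (t : ℕ) (_ : EnforcerWinsWithin F t), (t : ℕ∞)

/-- The board `E(K_n)`. -/
abbrev Edges (n : ℕ) : Type := {e : Sym2 (Fin n) // e ∈ (⊤ : SimpleGraph (Fin n)).edgeSet}

/-- The hypergraph on `E(K_n)` whose hyperedges are the edge sets of all non-bipartite graphs on
`n` vertices. -/
def NC2 (n : ℕ) : Set (Set (Edges n)) :=
  {S | ∃ G : SimpleGraph (Fin n), ¬ G.IsBipartite ∧ S = {e | e.1 ∈ G.edgeSet}}

end AvoiderEnforcer

namespace AvoiderEnforcer

/-! ### Plays, strategies and position invariants -/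

section Framework

variable {V : Type}

/-! Avoider's graph is bipartite exactly when it has a proper 2-colouring (`exists_subset_iff`), and
both bounds count edges against the at most n²/4 bichromatic edges of one colouring.

Enforcer claims an edge that is bichromatic in every proper colouring of Avoider's graph whenever
there is one; otherwise he wastes a move on an arbitrary edge. After a wasted move no free edge is
forced, so Avoider's next edge at least halves the number of proper colourings. There are 2^n of
them at the start and at least 2 while the graph is bipartite, so at most n - 1 moves are wasted.
All other claimed edges are bichromatic in a common colouring, hence at most n²/4 + n - 1 edges are
claimed before Enforcer wins (`FewWasted.card_le`, `enforcerWinsWithin_of_six_le`).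

Avoider first builds a matching, always destroying the only Enforcer edge between unmatched vertices
(`MatchingPhase.step`). A random balanced bipartition separating the matched pairs makes each other
edge monochromatic with probability at least 1/2, so some bipartition leaves about n/4 Enforcer
edges outside its cut (`exists_alternating_half`). Avoider then stays inside this cut of n²/4 edges,
and Enforcer's wasted edges buy him about n/8 extra rounds (`avoiderSurvives_general`). The boards
with n = 4 and n = 5 escape these estimates and are checked by computation. -/

theorem play_nodup (α σ : Strategy V) (m : ℕ) : (play α σ m).Nodup := by
  induction m with
  | zero => simp [play]
  | succ m ih =>
    rw [play]
    by_cases hv : ∃ v, v ∉ play α σ m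
    · rw [dif_pos hv]
      refine List.Nodup.append ih (by simp) ?_
      simp only [List.disjoint_singleton]
      split_ifs
      · exact (α _ hv).2
      · exact (σ _ hv).2
    · rwa [dif_neg hv]

theorem play_length (α σ : Strategy V) (m : ℕ) :
    (play α σ m).length ≤ m ∧
      ((play α σ m).length = m ∨ ∀ v, v ∈ play α σ m) := by
  induction m with
  | zero => simp [play]
  | succ m ih =>
    rw [play]
    by_cases hv : ∃ v, v ∉ play α σ m
    · have : (play α σ m).length = m := ih.2.resolve_right (by simpa using hv)
      simp [hv, this]
    · rw [dif_neg hv]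
      refine ⟨ih.1.trans (Nat.le_succ m), Or.inr ?_⟩
      simpa using hv

open Classical in
/-- A strategy that moves so as to satisfy `R` whenever this is possible. -/
noncomputable def strategyOf (R : List V → V → Prop) : Strategy V := fun h hv =>
  if hR : ∃ v, v ∉ h ∧ R h v then ⟨hR.choose, hR.choose_spec.1⟩ else ⟨hv.choose, hv.choose_spec⟩

theorem strategyOf_spec {R : List V → V → Prop} {h : List V} (hR : ∃ v, v ∉ h ∧ R h v)
    (hv : ∃ v, v ∉ h) : R h (strategyOf R h hv).1 := by
  unfold strategyOf
  rw [dif_pos hR]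
  exact hR.choose_spec.2

theorem play_prefix (α σ : Strategy V) {m k : ℕ} (h : m ≤ k) :
    play α σ m <+: play α σ k := by
  induction k, h using Nat.le_induction with
  | base => exact List.prefix_rfl
  | succ k _ ih =>
    refine ih.trans ?_
    rw [play]
    by_cases hv : ∃ v, v ∉ play α σ k
    · rw [dif_pos hv]
      exact List.prefix_append _ _
    · rw [dif_neg hv]

theorem AvoiderLosesWithin.mono {F : Set (Set V)} {α σ : Strategy V} {s t : ℕ} (hst : s ≤ t)
    (h : AvoiderLosesWithin F α σ s) : AvoiderLosesWithin F α σ t := by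
  obtain ⟨L, hL, hs⟩ := h
  refine ⟨L, hL, hs.trans ?_⟩
  rintro v ⟨i, hi⟩
  refine ⟨i, ?_⟩
  obtain ⟨l, hl⟩ := play_prefix α σ (Nat.mul_le_mul_left 2 hst)
  obtain ⟨hlt, -⟩ := List.getElem?_eq_some_iff.1 hi
  rw [← hl, List.getElem?_append_left hlt, hi]

/-- The two strategies are played against each other. -/
theorem lt_of_survives_of_wins {F : Set (Set V)} {s t : ℕ} (hs : AvoiderSurvives F s)
    (ht : EnforcerWinsWithin F t) : s < t := by
  obtain ⟨α, hα⟩ := hs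
  obtain ⟨σ, hσ⟩ := ht
  by_contra! h
  exact hα σ ((hσ α).mono h)

theorem exists_tauE_eq {F : Set (Set V)} {s t : ℕ} (hs : AvoiderSurvives F s)
    (ht : EnforcerWinsWithin F t) : ∃ k : ℕ, tauE F = k ∧ s < k ∧ k ≤ t := by
  classical
  have hex : ∃ k, EnforcerWinsWithin F k := ⟨t, ht⟩
  refine ⟨Nat.find hex, le_antisymm (iInf₂_le _ (Nat.find_spec hex)) ?_,
    lt_of_survives_of_wins hs (Nat.find_spec hex), Nat.find_min' hex ht⟩
  exact le_iInf₂ fun k hk => by exact_mod_cast Nat.find_min' hex hk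

variable [DecidableEq V]

/-- The elements claimed by the first (Avoider) and the second (Enforcer) player in a history. -/
def claims : List V → Finset V × Finset V
  | [] => (∅, ∅)
  | v :: l => (insert v (claims l).2, (claims l).1)

theorem mem_claims (l : List V) (x : V) :
    (x ∈ (claims l).1 ↔ ∃ i : ℕ, l[2 * i]? = some x) ∧
      (x ∈ (claims l).2 ↔ ∃ i : ℕ, l[2 * i + 1]? = some x) := by
  induction l with
  | nil => simp [claims]
  | cons v l ih =>
    refine ⟨?_, by simpa [claims] using ih.1⟩
    simp only [claims, Finset.mem_insert, ih.2]
    constructor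
    · rintro (rfl | ⟨i, hi⟩)
      · exact ⟨0, by simp⟩
      · exact ⟨i + 1, by simpa [mul_add] using hi⟩
    · rintro ⟨i, hi⟩
      cases i with
      | zero => left; simpa [eq_comm] using hi
      | succ i => right; exact ⟨i, by simpa [mul_add] using hi⟩

theorem avoiderSet_eq_claims (l : List V) : avoiderSet l = ((claims l).1 : Set V) := by
  ext x
  simp [avoiderSet, (mem_claims l x).1]

theorem mem_claims_union {l : List V} {x : V} : x ∈ (claims l).1 ∪ (claims l).2 ↔ x ∈ l := by
  induction l with
  | nil => simp [claims]
  | cons v l ih =>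
    simp only [Finset.mem_union] at ih
    simp only [claims, Finset.mem_union, Finset.mem_insert, List.mem_cons, ← ih]
    tauto

theorem claims_append_even {l : List V} (v : V) :
    (Even l.length → claims (l ++ [v]) = (insert v (claims l).1, (claims l).2)) ∧
      (¬ Even l.length → claims (l ++ [v]) = ((claims l).1, insert v (claims l).2)) := by
  induction l with
  | nil => simp [claims]
  | cons w l ih =>
    constructor
    · intro h
      have h' : ¬ Even l.length := by simpa [Nat.even_add_one] using h
      simp [claims, ih.2 h', Finset.insert_comm]
    · intro h
      have h' : Even l.length := by simpa [Nat.even_add_one] using h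
      simp [claims, ih.1 h']

theorem claims_of_nodup {l : List V} (hl : l.Nodup) :
    Disjoint (claims l).1 (claims l).2 ∧ (claims l).1.card = (l.length + 1) / 2 ∧
      (claims l).2.card = l.length / 2 := by
  induction l with
  | nil => simp [claims]
  | cons v l ih =>
    obtain ⟨hv, hl⟩ := List.nodup_cons.1 hl
    obtain ⟨h1, h2, h3⟩ := ih hl
    have hv' := mt mem_claims_union.1 hv
    simp only [Finset.mem_union, not_or] at hv'
    refine ⟨?_, ?_, ?_⟩
    · simp only [claims, Finset.disjoint_insert_left]
      exact ⟨hv'.1, h1.symm⟩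
    · simp only [claims, List.length_cons]
      rw [Finset.card_insert_of_notMem hv'.2, h3]
      omega
    · simp only [claims, List.length_cons, h2]

/-- The position invariant: `P` when Avoider is to move, `Q` when Enforcer is to move. -/
def PosInv (P Q : Finset V → Finset V → Prop) (h : List V) : Prop :=
  (Even h.length → P (claims h).1 (claims h).2) ∧ (¬ Even h.length → Q (claims h).1 (claims h).2)

theorem posInv_play {α σ : Strategy V} {P Q : Finset V → Finset V → Prop} {t : ℕ} (h0 : P ∅ ∅)
    (hA : ∀ h : List V, h.Nodup → Even h.length → h.length < 2 * t →
      P (claims h).1 (claims h).2 → ∀ hv, Q (insert (α h hv).1 (claims h).1) (claims h).2)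
    (hE : ∀ h : List V, h.Nodup → ¬ Even h.length → h.length < 2 * t →
      Q (claims h).1 (claims h).2 → ∀ hv, P (claims h).1 (insert (σ h hv).1 (claims h).2))
    {m : ℕ} (hm : m ≤ 2 * t) : PosInv P Q (play α σ m) := by
  induction m with
  | zero => simpa [PosInv, play, claims] using h0
  | succ m ih =>
    have ih := ih (by omega)
    have hlen := (play_length α σ m).1
    have hnd := play_nodup α σ m
    rw [play]
    split_ifs with hv he
    · have := hA _ hnd he (by omega) (ih.1 he) hv
      constructor
      · intro h; simp [Nat.even_add_one, he] at h
      · intro _; rwa [(claims_append_even _).1 he]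
    · have := hE _ hnd he (by omega) (ih.2 he) hv
      constructor
      · intro _; rwa [(claims_append_even _).2 he]
      · intro h; simp [Nat.even_add_one, he] at h
    · exact ih

/-- Reduces the game to local conditions on positions: Avoider moves greedily so as to reach `Q`.
Safety is also required in `Q`, because on a board of odd size the play stops right after a move of
Avoider. -/
theorem avoiderSurvives_of_invariant {F : Set (Set V)} {t : ℕ} (P Q : Finset V → Finset V → Prop)
    (h0 : P ∅ ∅)
    (hA : ∀ A E, Disjoint A E → A.card = E.card → E.card < t → P A E → (∃ v, v ∉ A ∪ E) →
      ∃ v, v ∉ A ∪ E ∧ Q (insert v A) E)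
    (hE : ∀ A E, Disjoint A E → A.card = E.card + 1 → E.card < t → Q A E →
      ∀ v, v ∉ A ∪ E → P A (insert v E))
    (hP : ∀ A E, P A E → ¬ ∃ L ∈ F, L ⊆ (A : Set V))
    (hQ : ∀ A E, Q A E → ¬ ∃ L ∈ F, L ⊆ (A : Set V)) : AvoiderSurvives F t := by
  refine ⟨strategyOf fun h v => Q (insert v (claims h).1) (claims h).2, fun σ => ?_⟩
  have key := posInv_play (α := strategyOf fun h v => Q (insert v (claims h).1) (claims h).2)
    (σ := σ) (P := P) (Q := Q) (t := t) h0 ?_ ?_ le_rfl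
  · unfold AvoiderLosesWithin
    rw [avoiderSet_eq_claims]
    by_cases he : Even (play (strategyOf fun h v => Q (insert v (claims h).1) (claims h).2) σ
      (2 * t)).length
    · exact hP _ _ (key.1 he)
    · exact hQ _ _ (key.2 he)
  · intro h hnd he hlt hp hv
    refine strategyOf_spec (R := fun h v => Q (insert v (claims h).1) (claims h).2) ?_ hv
    obtain ⟨h1, h2, h3⟩ := claims_of_nodup hnd
    obtain ⟨k, hk⟩ := he
    simpa only [mem_claims_union] using hA _ _ h1 (by omega) (by omega) hp
      (by simpa only [mem_claims_union] using hv)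
  · intro h hnd he hlt hq hv
    obtain ⟨h1, h2, h3⟩ := claims_of_nodup hnd
    obtain ⟨k, hk⟩ := Nat.not_even_iff_odd.1 he
    exact hE _ _ h1 (by omega) (by omega) hq _ (by simpa only [mem_claims_union] using (σ h hv).2)

theorem enforcerWinsWithin_of_invariant {F : Set (Set V)} {t : ℕ}
    (P Q : Finset V → Finset V → Prop) (h0 : P ∅ ∅)
    (hA : ∀ A E, Disjoint A E → A.card = E.card → E.card < t → P A E →
      ∀ v, v ∉ A ∪ E → Q (insert v A) E)
    (hE : ∀ A E, Disjoint A E → A.card = E.card + 1 → E.card < t → Q A E → (∃ v, v ∉ A ∪ E) →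
      ∃ v, v ∉ A ∪ E ∧ P A (insert v E))
    (hP : ∀ A E, Disjoint A E → A.card = E.card → P A E → (A.card = t ∨ ∀ v, v ∈ A ∪ E) →
      ∃ L ∈ F, L ⊆ (A : Set V))
    (hQ : ∀ A E, Disjoint A E → A.card = E.card + 1 → Q A E → (∀ v, v ∈ A ∪ E) →
      ∃ L ∈ F, L ⊆ (A : Set V)) :
    EnforcerWinsWithin F t := by
  refine ⟨strategyOf fun h v => P (claims h).1 (insert v (claims h).2), fun α => ?_⟩
  set σ : Strategy V := strategyOf fun h v => P (claims h).1 (insert v (claims h).2) with hσ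
  have key := posInv_play (α := α) (σ := σ) (P := P) (Q := Q) (t := t) h0 ?_ ?_ le_rfl
  · unfold AvoiderLosesWithin
    rw [avoiderSet_eq_claims]
    obtain ⟨h1, h2, h3⟩ := claims_of_nodup (play_nodup α σ (2 * t))
    have hlen := (play_length α σ (2 * t)).2
    by_cases he : Even (play α σ (2 * t)).length
    · have he' := he
      obtain ⟨k, hk⟩ := he'
      refine hP _ _ h1 (by omega) (key.1 he) ?_
      simp only [mem_claims_union]
      exact hlen.imp_left fun h => by omega
    · have he' := Nat.not_even_iff_odd.1 he
      obtain ⟨k, hk⟩ := he'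
      refine hQ _ _ h1 (by omega) (key.2 he) ?_
      simp only [mem_claims_union]
      exact hlen.resolve_left fun h => by omega
  · intro h hnd he hlt hp hv
    obtain ⟨h1, h2, h3⟩ := claims_of_nodup hnd
    obtain ⟨k, hk⟩ := he
    exact hA _ _ h1 (by omega) (by omega) hp _ (by simpa only [mem_claims_union] using (α h hv).2)
  · intro h hnd he hlt hq hv
    refine strategyOf_spec (R := fun h v => P (claims h).1 (insert v (claims h).2)) ?_ hv
    obtain ⟨h1, h2, h3⟩ := claims_of_nodup hnd
    obtain ⟨k, hk⟩ := Nat.not_even_iff_odd.1 he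
    simpa only [mem_claims_union] using hE _ _ h1 (by omega) (by omega) hq
      (by simpa only [mem_claims_union] using hv)

end Framework

/-! ### Proper 2-colourings and cuts -/

section Colorings

variable {n : ℕ}

/-- The edge `xy` of the complete graph. -/
def mkEdge (x y : Fin n) (h : x ≠ y) : Edges n := ⟨s(x, y), by simpa using h⟩

theorem exists_eq_mkEdge (e : Edges n) : ∃ (x y : Fin n) (h : x ≠ y), e = mkEdge x y h := by
  obtain ⟨e, he⟩ := e
  induction e using Sym2.ind with
  | _ x y => exact ⟨x, y, by simpa using he, rfl⟩

theorem mkEdge_comm {x y : Fin n} (h : x ≠ y) : mkEdge x y h = mkEdge y x h.symm :=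
  Subtype.ext Sym2.eq_swap

theorem mkEdge_eq_iff {x y u v : Fin n} (h : x ≠ y) (h' : u ≠ v) :
    mkEdge x y h = mkEdge u v h' ↔ (x = u ∧ y = v) ∨ (x = v ∧ y = u) := by
  simp [mkEdge]

/-- The ends of the edge `e` have different colours. -/
def Bichrom (c : Fin n → Bool) (e : Edges n) : Prop := ¬ (Sym2.map c e.1).IsDiag

instance (c : Fin n → Bool) : DecidablePred (Bichrom c) := fun e => by
  unfold Bichrom; infer_instance

@[simp] theorem bichrom_mkEdge (c : Fin n → Bool) {x y : Fin n} (h : x ≠ y) :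
    Bichrom c (mkEdge x y h) ↔ c x ≠ c y := by
  simp [Bichrom, mkEdge]

/-- The colourings for which all edges of `A` are bichromatic. -/
def properColorings (A : Finset (Edges n)) : Finset (Fin n → Bool) :=
  Finset.univ.filter fun c => ∀ e ∈ A, Bichrom c e

@[simp] theorem mem_properColorings {A : Finset (Edges n)} {c : Fin n → Bool} :
    c ∈ properColorings A ↔ ∀ e ∈ A, Bichrom c e := by
  simp [properColorings]

theorem exists_subset_iff (A : Finset (Edges n)) :
    (∃ L ∈ NC2 n, L ⊆ (A : Set (Edges n))) ↔ ¬ (properColorings A).Nonempty := by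
  constructor
  · rintro ⟨L, ⟨G, hG, rfl⟩, hL⟩ ⟨c, hc⟩
    refine hG ⟨SimpleGraph.Coloring.mk (fun v => if c v then (0 : Fin 2) else 1) ?_⟩
    intro x y hxy
    have hmem : mkEdge x y hxy.ne ∈ A := hL (by simpa [mkEdge] using hxy)
    have hb := mem_properColorings.1 hc _ hmem
    rw [bichrom_mkEdge] at hb
    cases hx : c x <;> cases hy : c y <;> simp_all
  · intro h
    refine ⟨A, ⟨SimpleGraph.fromEdgeSet (Subtype.val '' (A : Set (Edges n))), ?_, ?_⟩, subset_rfl⟩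
    · rintro ⟨c⟩
      refine h ⟨fun v => c v = 0, mem_properColorings.2 fun e he => ?_⟩
      obtain ⟨x, y, hxy, rfl⟩ := exists_eq_mkEdge e
      have hadj : (SimpleGraph.fromEdgeSet (Subtype.val '' (A : Set (Edges n)))).Adj x y := by
        rw [SimpleGraph.fromEdgeSet_adj]
        exact ⟨⟨_, he, rfl⟩, hxy⟩
      have hne := c.valid hadj
      rw [bichrom_mkEdge]
      generalize c x = i at *
      generalize c y = j at *
      revert i j
      decide
    · ext e
      have := e.2
      simp only [SimpleGraph.edgeSet_top, Set.mem_compl_iff] at this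
      simp only [SimpleGraph.edgeSet_fromEdgeSet, Set.mem_sdiff, Set.mem_ofPred_eq,
        Subtype.val_injective.mem_set_image]
      constructor
      · exact fun h => ⟨h, this⟩
      · exact fun h => h.1

theorem not_exists_subset {A : Finset (Edges n)} (h : (properColorings A).Nonempty) :
    ¬ ∃ L ∈ NC2 n, L ⊆ (A : Set (Edges n)) := by
  rwa [exists_subset_iff, not_not]

theorem card_bichrom (c : Fin n → Bool) :
    (Finset.univ.filter (Bichrom c)).card =
      (Finset.univ.filter fun v => c v = true).card *
        (Finset.univ.filter fun v => c v = false).card := by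
  rw [← Finset.card_product]
  symm
  refine Finset.card_bij
    (fun p hp => mkEdge p.1 p.2 (fun h => by simp_all)) ?_ ?_ ?_
  · intro p hp
    simp only [Finset.mem_product, Finset.mem_filter, Finset.mem_univ, true_and] at hp
    simp [hp]
  · intro p hp q hq h
    simp only [Finset.mem_product, Finset.mem_filter, Finset.mem_univ, true_and] at hp hq
    rw [mkEdge_eq_iff] at h
    rcases h with h | h
    · exact Prod.ext h.1 h.2
    · rw [h.1, hq.2] at hp
      simp at hp
  · intro e he
    obtain ⟨x, y, hxy, rfl⟩ := exists_eq_mkEdge e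
    simp only [Finset.mem_filter, Finset.mem_univ, true_and, bichrom_mkEdge] at he
    cases hx : c x
    · cases hy : c y
      · simp_all
      · exact ⟨(y, x), by simp [hx, hy], mkEdge_comm _⟩
    · cases hy : c y
      · exact ⟨(x, y), by simp [hx, hy], rfl⟩
      · simp_all

theorem card_true_add_card_false (c : Fin n → Bool) :
    (Finset.univ.filter fun v => c v = true).card +
        (Finset.univ.filter fun v => c v = false).card = n := by
  have := Finset.card_filter_add_card_filter_not (s := (Finset.univ : Finset (Fin n)))
    (fun v => c v = true)
  simpa using this

theorem card_bichrom_le (c : Fin n → Bool) : (Finset.univ.filter (Bichrom c)).card ≤ n ^ 2 / 4 := by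
  rw [card_bichrom, Nat.le_div_iff_mul_le (by norm_num)]
  have h := card_true_add_card_false c
  generalize (Finset.univ.filter fun v => c v = true).card = a at *
  generalize (Finset.univ.filter fun v => c v = false).card = b at *
  subst h
  nlinarith [four_mul_le_sq_add a b]

theorem card_edges : Fintype.card (Edges n) = n * (n - 1) / 2 := by
  have := SimpleGraph.card_edgeFinset_top_eq_card_choose_two (V := Fin n)
  rw [Fintype.card_fin, Nat.choose_two_right] at this
  rw [← this, SimpleGraph.edgeFinset_card]

/-- The proper colourings form an affine space over the field with two elements. If `c` is
monochromatic on `e` and `d` is bichromatic, translation by `c + d` injects the colourings surviving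
the insertion of `e` into those it kills. -/
theorem two_mul_card_properColorings_insert_le {A : Finset (Edges n)} {e : Edges n}
    (h : ∃ c ∈ properColorings A, ¬ Bichrom c e) :
    2 * (properColorings (insert e A)).card ≤ (properColorings A).card := by
  rcases (properColorings (insert e A)).eq_empty_or_nonempty with h0 | ⟨d, hd⟩
  · simp [h0]
  obtain ⟨c, hc, hce⟩ := h
  have hsub : properColorings (insert e A) ⊆ properColorings A := by
    intro b hb
    simp only [mem_properColorings, Finset.mem_insert, forall_eq_or_imp] at hb ⊢
    exact hb.2
  have hcard : (properColorings (insert e A)).card ≤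
      (properColorings A \ properColorings (insert e A)).card := by
    refine Finset.card_le_card_of_injOn (fun b v => xor (b v) (xor (c v) (d v))) ?_ ?_
    · intro b hb
      simp only [Finset.mem_coe, Finset.mem_sdiff, mem_properColorings, Finset.mem_insert,
        forall_eq_or_imp] at hb hd hc ⊢
      refine ⟨fun f hf => ?_, fun hcon => ?_⟩
      · have h1 := hb.2 f hf
        have h2 := hd.2 f hf
        have h3 := hc f hf
        obtain ⟨x, y, hxy, rfl⟩ := exists_eq_mkEdge f
        simp only [bichrom_mkEdge] at *
        generalize b x = b1 at *; generalize b y = b2 at *; generalize c x = c1 at *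
        generalize c y = c2 at *; generalize d x = d1 at *; generalize d y = d2 at *
        clear * - h1 h2 h3
        revert b1 b2 c1 c2 d1 d2; decide
      · have h1 := hb.1
        have h2 := hd.1
        have h3 := hcon.1
        obtain ⟨x, y, hxy, rfl⟩ := exists_eq_mkEdge e
        simp only [bichrom_mkEdge] at *
        generalize b x = b1 at *; generalize b y = b2 at *; generalize c x = c1 at *
        generalize c y = c2 at *; generalize d x = d1 at *; generalize d y = d2 at *
        clear * - h1 h2 h3 hce
        revert b1 b2 c1 c2 d1 d2; decide
    · intro b _ b' _ hbb
      funext v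
      have := congrFun hbb v
      simpa using this
  rw [Finset.card_sdiff_of_subset hsub] at hcard
  have := Finset.card_le_card hsub
  omega

/-- Complementing all colours preserves properness. -/
theorem two_le_card_properColorings {A : Finset (Edges n)} (hn : 0 < n)
    (h : (properColorings A).Nonempty) : 2 ≤ (properColorings A).card := by
  obtain ⟨c, hc⟩ := h
  refine Finset.one_lt_card.2 ⟨c, hc, fun v => !c v, ?_, ?_⟩
  · simp only [mem_properColorings] at hc ⊢
    intro e he
    have := hc e he
    obtain ⟨x, y, hxy, rfl⟩ := exists_eq_mkEdge e
    simpa using this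
  · intro h
    have := congrFun h ⟨0, hn⟩
    simp at this

end Colorings

/-! ### Enforcer's strategy: forced edges and wasted edges -/

section Enforcer

variable {n : ℕ}

/-- The edge `e` joins different sides of a component of the bipartite graph `A`. -/
def Forced (A : Finset (Edges n)) (e : Edges n) : Prop := ∀ c ∈ properColorings A, Bichrom c e

theorem Forced.insert {A : Finset (Edges n)} {e : Edges n} (h : Forced A e) (v : Edges n) :
    Forced (insert v A) e := by
  intro c hc
  refine h c ?_
  simp only [mem_properColorings, Finset.mem_insert, forall_eq_or_imp] at hc ⊢
  exact hc.2

/-- Apart from a set `W` of wasted edges, Enforcer's edges `E` are forced, and `2 ^ |W|` is at most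
`2 ^ n / b` divided by the number of proper colourings of `A`. -/
def FewWasted (b : ℕ) (A E : Finset (Edges n)) : Prop :=
  ∃ W ⊆ E, (∀ e ∈ E, e ∉ W → Forced A e) ∧
    2 ^ W.card * (b * (properColorings A).card) ≤ 2 ^ n

theorem FewWasted.card_le {A E : Finset (Edges n)} (hn : 0 < n) (hd : Disjoint A E)
    (hA : (properColorings A).Nonempty) (h : FewWasted 1 A E) :
    A.card + E.card ≤ n ^ 2 / 4 + (n - 1) := by
  obtain ⟨W, hW, hf, hcard⟩ := h
  have h2 := two_le_card_properColorings hn hA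
  have hWn : W.card + 1 ≤ n := by
    -- The two complementary colourings supply the extra factor 2, so fewer than `n` edges are
    -- wasted.
    rw [← Nat.pow_le_pow_iff_right (a := 2) (by norm_num), pow_succ]
    exact le_trans (Nat.mul_le_mul_left _ (by omega)) hcard
  obtain ⟨c, hc⟩ := hA
  have hsub : A ∪ (E \ W) ⊆ Finset.univ.filter (Bichrom c) := by
    intro e he
    simp only [Finset.mem_union, Finset.mem_sdiff, Finset.mem_filter, Finset.mem_univ,
      true_and] at he ⊢
    rcases he with he | he
    · exact mem_properColorings.1 hc e he
    · exact hf e he.1 he.2 c hc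
  have h3 := (Finset.card_le_card hsub).trans (card_bichrom_le c)
  rw [Finset.card_union_of_disjoint (Finset.disjoint_of_subset_right Finset.sdiff_subset hd),
    Finset.card_sdiff_of_subset hW] at h3
  omega

theorem enforcerWinsWithin_of_six_le (hn : 6 ≤ n) :
    EnforcerWinsWithin (NC2 n) ((n ^ 2 / 4 + (n - 1)) / 2 + 1) := by
  have weaken : ∀ A E : Finset (Edges n), FewWasted 2 A E → FewWasted 1 A E := by
    rintro A E ⟨W, hW, hf, h⟩
    refine ⟨W, hW, hf, le_trans ?_ h⟩
    gcongr
    norm_num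
  -- A full board exceeds the bound of `FewWasted.card_le`. This needs `6 ≤ n`: for `n = 5` both
  -- numbers are 10.
  have full : ∀ A E : Finset (Edges n), Disjoint A E → (∀ v, v ∈ A ∪ E) →
      n ^ 2 / 4 + (n - 1) < A.card + E.card := by
    intro A E hd hv
    rw [← Finset.card_union_of_disjoint hd, Finset.eq_univ_iff_forall.2 hv, Finset.card_univ,
      card_edges]
    obtain ⟨k, rfl⟩ := Nat.exists_eq_add_of_le hn
    have h1 : (6 + k) ^ 2 / 4 ≤ (36 + 12 * k + k * k) / 4 := by
      apply Nat.div_le_div_right; nlinarith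
    have h2 : (30 + 11 * k + k * k) / 2 ≤ (6 + k) * (6 + k - 1) / 2 := by
      apply Nat.div_le_div_right
      have : 6 + k - 1 = 5 + k := by omega
      rw [this]; nlinarith
    generalize k * k = m at *
    omega
  -- A wasted move uses up the factor 2 in `FewWasted 2`; it is only made when no free edge is
  -- forced, and then Avoider's next move restores the factor. The invariants are vacuous once
  -- Avoider's graph is non-bipartite.
  refine enforcerWinsWithin_of_invariant
    (fun A E => (properColorings A).Nonempty →
      FewWasted 2 A E ∨ (FewWasted 1 A E ∧ ∀ e, e ∉ A ∪ E → ¬ Forced A e))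
    (fun A E => (properColorings A).Nonempty → FewWasted 2 A E) ?_ ?_ ?_ ?_ ?_
  · intro _
    refine Or.inr ⟨⟨∅, by simp, by simp, ?_⟩, ?_⟩
    · simpa using Finset.card_le_univ (properColorings (∅ : Finset (Edges n)))
    · intro e _ h
      have := h (fun _ => true) (by simp)
      obtain ⟨x, y, hxy, rfl⟩ := exists_eq_mkEdge e
      simp at this
  · intro A E hd _ _ hP v hv hne
    have hsub : properColorings (insert v A) ⊆ properColorings A := by
      intro b hb
      simp only [mem_properColorings, Finset.mem_insert, forall_eq_or_imp] at hb ⊢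
      exact hb.2
    rcases hP (hne.mono hsub) with ⟨W, hW, hf, h⟩ | ⟨⟨W, hW, hf, h⟩, hno⟩
    · refine ⟨W, hW, fun e he he' => (hf e he he').insert v, le_trans ?_ h⟩
      gcongr
    · refine ⟨W, hW, fun e he he' => (hf e he he').insert v, le_trans ?_ h⟩
      rw [one_mul]
      refine Nat.mul_le_mul_left _ (two_mul_card_properColorings_insert_le ?_)
      simpa [Forced] using hno v hv
  · intro A E hd _ _ hQ hv
    by_cases hex : ∃ v, v ∉ A ∪ E ∧ Forced A v
    · obtain ⟨v, hv, hvf⟩ := hex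
      refine ⟨v, hv, fun hne => Or.inl ?_⟩
      obtain ⟨W, hW, hf, h⟩ := hQ hne
      refine ⟨W, hW.trans (Finset.subset_insert _ _), fun e he he' => ?_, h⟩
      rcases Finset.mem_insert.1 he with rfl | he
      · exact hvf
      · exact hf e he he'
    · push Not at hex
      obtain ⟨v, hv⟩ := hv
      refine ⟨v, hv, fun hne => Or.inr ⟨?_, fun e he => hex e ?_⟩⟩
      · obtain ⟨W, hW, hf, h⟩ := hQ hne
        refine ⟨insert v W, Finset.insert_subset_insert _ hW, fun e he he' => ?_, ?_⟩
        · simp only [Finset.mem_insert, not_or] at he he'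
          exact hf e (he.resolve_left he'.1) he'.2
        · rw [Finset.card_insert_of_notMem fun h => hv (Finset.mem_union_right _ (hW h))]
          convert h using 1
          ring
      · simp only [Finset.mem_union, Finset.mem_insert, not_or] at he ⊢
        tauto
  · intro A E hd hc hP ht
    rw [exists_subset_iff]
    intro hne
    have h1 : FewWasted 1 A E := (hP hne).elim (weaken A E) And.left
    have h2 := h1.card_le (by omega) hd hne
    rcases ht with ht | ht
    · omega
    · have := full A E hd ht
      omega
  · intro A E hd hc hQ ht
    rw [exists_subset_iff]
    intro hne
    have h2 := (weaken A E (hQ hne)).card_le (by omega) hd hne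
    have := full A E hd ht
    omega

end Enforcer

/-! ### Avoider's strategy: a matching, then a balanced bipartition -/

section Avoider

variable {n : ℕ}

/-- The colourings giving different colours to the two elements of each pair `{v, q v}`. -/
def alternating (q : Fin n → Fin n) : Finset (Fin n → Bool) :=
  Finset.univ.filter fun c => ∀ v, q v ≠ v → c (q v) ≠ c v

theorem alternating_nonempty {q : Fin n → Fin n} (hq : Function.Involutive q) :
    (alternating q).Nonempty := by
  refine ⟨fun v => decide (v < q v), ?_⟩
  simp only [alternating, Finset.mem_filter, Finset.mem_univ, true_and]
  intro v hv
  rw [hq v]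
  rcases lt_or_gt_of_ne hv with h | h
  · simp [h, h.le]
  · simp [h, h.le]

/-- Flipping both colours on the pair `{x, q x}` keeps a colouring alternating, and it changes the
status of `xy` since `y` lies outside the pair. -/
theorem card_alternating_le {q : Fin n → Fin n} (hq : Function.Involutive q) {x y : Fin n}
    (hxy : x ≠ y) (hne : q x ≠ y) :
    (alternating q).card ≤
      2 * ((alternating q).filter fun c => ¬ Bichrom c (mkEdge x y hxy)).card := by
  have h1 := Finset.card_filter_add_card_filter_not (s := alternating q)
    (fun c => Bichrom c (mkEdge x y hxy))
  have h2 : ((alternating q).filter fun c => Bichrom c (mkEdge x y hxy)).card ≤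
      ((alternating q).filter fun c => ¬ Bichrom c (mkEdge x y hxy)).card := by
    refine Finset.card_le_card_of_injOn
      (fun c v => if v = x ∨ v = q x then !c v else c v) ?_ ?_
    · intro c hc
      simp only [alternating, Finset.coe_filter, Finset.mem_filter, Finset.mem_univ, true_and,
        Set.mem_ofPred_eq, bichrom_mkEdge] at hc ⊢
      refine ⟨fun v hv => ?_, ?_⟩
      · have h := hc.1 v hv
        have e1 : q v = q x ↔ v = x := hq.injective.eq_iff
        have e2 : q v = x ↔ v = q x := ⟨fun h => by rw [← h, hq], fun h => by rw [h, hq]⟩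
        simp only [e1, e2, or_comm (a := v = q x)]
        by_cases hh : v = x ∨ v = q x
        · simp only [if_pos hh]
          simpa using h
        · simpa only [if_neg hh] using h
      · have h := hc.2
        simp only [true_or, if_true, if_neg (not_or.2 ⟨hxy.symm, hne.symm⟩)]
        cases hx : c x <;> cases hy : c y <;> simp_all
    · intro c _ d _ h
      funext v
      have := congrFun h v
      simp only at this
      split_ifs at this
      · simpa using this
      · exact this
  omega

/-- Some alternating colouring makes at least half of the edges of `E` monochromatic. -/
theorem exists_alternating_half {q : Fin n → Fin n} (hq : Function.Involutive q)
    (E : Finset (Edges n)) (hE : ∀ x y h, mkEdge x y h ∈ E → q x ≠ y) :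
    ∃ c ∈ alternating q, E.card ≤ 2 * (E.filter fun e => ¬ Bichrom c e).card := by
  -- Average over all alternating colourings and exchange the order of summation.
  refine Finset.exists_le_of_sum_le (alternating_nonempty hq) ?_
  rw [← Finset.mul_sum]
  have h1 : ∑ c ∈ alternating q, (E.filter fun e => ¬ Bichrom c e).card =
      ∑ e ∈ E, ((alternating q).filter fun c => ¬ Bichrom c e).card :=
    Finset.sum_card_bipartiteAbove_eq_sum_card_bipartiteBelow (fun c e => ¬ Bichrom c e)
  rw [h1, Finset.sum_const, smul_eq_mul, mul_comm, Finset.mul_sum, ← smul_eq_mul,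
    ← Finset.sum_const]
  refine Finset.sum_le_sum fun e he => ?_
  obtain ⟨x, y, hxy, rfl⟩ := exists_eq_mkEdge e
  exact card_alternating_le hq hxy (hE x y hxy he)

/-- `q` injects the non-fixed vertices of one colour into the other colour class. -/
theorem card_color_le {q : Fin n → Fin n} (hq : Function.Involutive q) {c : Fin n → Bool}
    (hc : c ∈ alternating q) (k : Bool) :
    (Finset.univ.filter fun v => c v = k).card ≤
      (Finset.univ.filter fun v => c v = !k).card + (Finset.univ.filter fun v => q v = v).card := by
  have h1 := Finset.card_filter_add_card_filter_not
    (s := Finset.univ.filter fun v => c v = k) (fun v => q v = v)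
  have h2 : ((Finset.univ.filter fun v => c v = k).filter fun v => q v = v).card ≤
      (Finset.univ.filter fun v => q v = v).card :=
    Finset.card_le_card (Finset.filter_subset_filter _ (Finset.filter_subset _ _))
  have h3 : ((Finset.univ.filter fun v => c v = k).filter fun v => ¬ q v = v).card ≤
      (Finset.univ.filter fun v => c v = !k).card := by
    refine Finset.card_le_card_of_injOn q ?_ hq.injective.injOn
    intro v hv
    simp only [Finset.coe_filter, Finset.mem_filter, Finset.mem_univ, true_and,
      Set.mem_ofPred_eq] at hv ⊢
    simp only [alternating, Finset.mem_filter, Finset.mem_univ, true_and] at hc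
    have := hc v hv.2
    rw [hv.1] at this
    cases k <;> simpa using this
  omega

theorem sq_div_four_le_card_bichrom {q : Fin n → Fin n} (hq : Function.Involutive q)
    (hfix : (Finset.univ.filter fun v => q v = v).card ≤ 1) {c : Fin n → Bool}
    (hc : c ∈ alternating q) : n ^ 2 / 4 ≤ (Finset.univ.filter (Bichrom c)).card := by
  rw [card_bichrom]
  have h1 := card_color_le hq hc true
  have h2 := card_color_le hq hc false
  have h := card_true_add_card_false c
  simp only [Bool.not_true, Bool.not_false] at h1 h2
  generalize (Finset.univ.filter fun v => c v = true).card = a at *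
  generalize (Finset.univ.filter fun v => c v = false).card = b at *
  subst h
  have h3 : a = b ∨ a = b + 1 ∨ b = a + 1 := by omega
  rw [Nat.div_le_iff_le_mul_add_pred (by norm_num)]
  rcases h3 with rfl | rfl | rfl <;> nlinarith

/-- Exchange the two elements `u`, `v` in an involution which fixes both. -/
def pairUp (p : Fin n → Fin n) (u v : Fin n) : Fin n → Fin n :=
  fun x => if x = u then v else if x = v then u else p x

theorem pairUp_involutive {p : Fin n → Fin n} (hp : Function.Involutive p) {u v : Fin n}
    (hu : p u = u) (hv : p v = v) : Function.Involutive (pairUp p u v) := by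
  intro x
  have e1 : p x = u ↔ x = u := ⟨fun h => by rw [← hp x, h, hu], fun h => by rw [h, hu]⟩
  have e2 : p x = v ↔ x = v := ⟨fun h => by rw [← hp x, h, hv], fun h => by rw [h, hv]⟩
  unfold pairUp
  by_cases h1 : x = u
  · subst h1
    by_cases h2 : v = x <;> simp [h2]
  · by_cases h2 : x = v
    · simp [h2]
    · simp [h1, h2, e1, e2, hp x]

theorem card_fixed_pairUp {p : Fin n → Fin n} {u v : Fin n} (huv : u ≠ v)
    (hu : p u = u) (hv : p v = v) :
    (Finset.univ.filter fun x => pairUp p u v x = x).card + 2 =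
      (Finset.univ.filter fun x => p x = x).card := by
  have : (Finset.univ.filter fun x => pairUp p u v x = x) =
      ((Finset.univ.filter fun x => p x = x).erase u).erase v := by
    ext x
    rw [Finset.mem_erase, Finset.mem_erase, Finset.mem_filter, Finset.mem_filter]
    simp only [Finset.mem_univ, true_and, pairUp]
    by_cases h1 : x = u
    · simp [h1, huv.symm]
    · by_cases h2 : x = v
      · simp [h2, huv, huv.symm]
      · simp [h1, h2]
  rw [this, Finset.card_erase_of_mem, Finset.card_erase_of_mem]
  · have : 1 < (Finset.univ.filter fun x => p x = x).card :=
      Finset.one_lt_card.2 ⟨u, by simp [hu], v, by simp [hv], huv⟩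
    omega
  · simp [hu]
  · simp [hv, huv.symm]

/-- The edges with both ends fixed by `p`. -/
def insideFixed (p : Fin n → Fin n) (E : Finset (Edges n)) : Finset (Edges n) :=
  E.filter fun e => ∀ x ∈ e.1, p x = x

theorem mkEdge_mem_insideFixed {p : Fin n → Fin n} {E : Finset (Edges n)} {x y : Fin n}
    (h : x ≠ y) : mkEdge x y h ∈ insideFixed p E ↔ mkEdge x y h ∈ E ∧ p x = x ∧ p y = y := by
  simp [insideFixed, mkEdge]

/-- Avoider's edges form a matching, the pairs of the involution `p`, and Enforcer has at most `k`
edges between unmatched vertices. -/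
def MatchingPhase (k : ℕ) (A E : Finset (Edges n)) : Prop :=
  ∃ p : Fin n → Fin n, Function.Involutive p ∧ (∀ x y h, mkEdge x y h ∈ A ↔ p x = y) ∧
    (Finset.univ.filter fun x => p x = x).card + 2 * A.card = n ∧ (insideFixed p E).card ≤ k

/-- Avoider follows a balanced bipartition outside which Enforcer has claimed many edges. -/
def BipartitionPhase (A E : Finset (Edges n)) : Prop :=
  ∃ c ∈ properColorings A, n ^ 2 / 4 ≤ (Finset.univ.filter (Bichrom c)).card ∧
    (n - 1) / 4 ≤ (E.filter fun e => ¬ Bichrom c e).card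

theorem mem_properColorings_of_alternating {p : Fin n → Fin n} {A : Finset (Edges n)}
    (hA : ∀ x y h, mkEdge x y h ∈ A → p x = y) {c : Fin n → Bool} (hc : c ∈ alternating p) :
    c ∈ properColorings A := by
  simp only [alternating, Finset.mem_filter, Finset.mem_univ, true_and] at hc
  refine mem_properColorings.2 fun e he => ?_
  obtain ⟨x, y, hxy, rfl⟩ := exists_eq_mkEdge e
  have h := hA x y hxy he
  have := hc x (by rw [h]; exact hxy.symm)
  rw [h] at this
  rw [bichrom_mkEdge]
  exact this.symm

theorem MatchingPhase.properColorings_nonempty {k : ℕ} {A E : Finset (Edges n)}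
    (h : MatchingPhase k A E) : (properColorings A).Nonempty := by
  obtain ⟨p, hp, hA, -⟩ := h
  obtain ⟨c, hc⟩ := alternating_nonempty hp
  exact ⟨c, mem_properColorings_of_alternating (fun x y h => (hA x y h).1) hc⟩

/-- With at least three unmatched vertices, Avoider can match an end of the only Enforcer edge among
them to a third vertex, so that no such edge remains. -/
theorem MatchingPhase.step {A E : Finset (Edges n)} (h : MatchingPhase 1 A E)
    (hcard : 2 * A.card + 3 ≤ n) : ∃ v, v ∉ A ∪ E ∧ MatchingPhase 0 (insert v A) E := by
  obtain ⟨p, hp, hA, hfix, hE⟩ := h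
  have move : ∀ u v (huv : u ≠ v), p u = u → p v = v → mkEdge u v huv ∉ E →
      insideFixed (pairUp p u v) E = ∅ → ∃ e, e ∉ A ∪ E ∧ MatchingPhase 0 (insert e A) E := by
    intro u v huv hu hv hnE hemp
    have hnA : mkEdge u v huv ∉ A := by
      rw [hA, hu]; exact huv
    refine ⟨mkEdge u v huv, by simp [hnA, hnE], pairUp p u v, pairUp_involutive hp hu hv, ?_, ?_,
      by simp [hemp]⟩
    · intro x y hxy
      rw [Finset.mem_insert, hA, mkEdge_eq_iff]
      unfold pairUp
      by_cases h1 : x = u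
      · subst h1
        simp only [hu, if_true, true_and]
        constructor
        · rintro ((h | h) | h)
          · exact h.symm
          · exact absurd h.1 huv
          · exact absurd h hxy
        · exact fun h => Or.inl (Or.inl h.symm)
      · by_cases h2 : x = v
        · subst h2
          simp only [hv, h1, if_true, if_false, false_and, true_and, false_or]
          constructor
          · rintro (h | h)
            · exact h.symm
            · exact absurd h hxy
          · exact fun h => Or.inl h.symm
        · simp [h1, h2]
    · rw [Finset.card_insert_of_notMem hnA]
      have := card_fixed_pairUp huv hu hv
      omega
  have hthree : 2 < (Finset.univ.filter fun x => p x = x).card := by omega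
  rcases (insideFixed p E).eq_empty_or_nonempty with h0 | ⟨e, he⟩
  · obtain ⟨u, v, w, hu, hv, hw, huv, -⟩ := Finset.two_lt_card_iff.1 hthree
    simp only [Finset.mem_filter, Finset.mem_univ, true_and] at hu hv
    refine move u v huv hu hv ?_ ?_
    · intro hmem
      have : mkEdge u v huv ∈ insideFixed p E := (mkEdge_mem_insideFixed huv).2 ⟨hmem, hu, hv⟩
      simp [h0] at this
    · rw [Finset.eq_empty_iff_forall_notMem]
      intro f hf
      obtain ⟨x, y, hxy, rfl⟩ := exists_eq_mkEdge f
      rw [mkEdge_mem_insideFixed] at hf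
      have : mkEdge x y hxy ∈ insideFixed p E := by
        refine (mkEdge_mem_insideFixed hxy).2 ⟨hf.1, ?_, ?_⟩
        · have := hf.2.1
          unfold pairUp at this
          split_ifs at this <;> simp_all
        · have := hf.2.2
          unfold pairUp at this
          split_ifs at this <;> simp_all
      simp [h0] at this
  · obtain ⟨u, y, huy, rfl⟩ := exists_eq_mkEdge e
    have huniq : ∀ f ∈ insideFixed p E, f = mkEdge u y huy := fun f hf =>
      Finset.card_le_one.1 hE f hf _ he
    rw [mkEdge_mem_insideFixed] at he
    obtain ⟨v, hv⟩ : ((Finset.univ.filter fun x => p x = x) \ {u, y}).Nonempty := by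
      rw [← Finset.card_pos]
      have := Finset.le_card_sdiff ({u, y} : Finset (Fin n)) (Finset.univ.filter fun x => p x = x)
      have h2 : ({u, y} : Finset (Fin n)).card ≤ 2 := Finset.card_le_two
      omega
    simp only [Finset.mem_sdiff, Finset.mem_filter, Finset.mem_univ, true_and, Finset.mem_insert,
      Finset.mem_singleton, not_or] at hv
    have huv : u ≠ v := fun h => hv.2.1 h.symm
    refine move u v huv he.2.1 hv.1 ?_ ?_
    · intro hmem
      have := huniq _ ((mkEdge_mem_insideFixed huv).2 ⟨hmem, he.2.1, hv.1⟩)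
      rw [mkEdge_eq_iff] at this
      rcases this with h | h
      · exact hv.2.2 h.2
      · exact huy h.1
    · rw [Finset.eq_empty_iff_forall_notMem]
      intro f hf
      obtain ⟨x, z, hxz, rfl⟩ := exists_eq_mkEdge f
      rw [mkEdge_mem_insideFixed] at hf
      have key : ∀ w, pairUp p u v w = w → p w = w ∧ w ≠ u := by
        intro w hw
        unfold pairUp at hw
        split_ifs at hw with h1 h2
        · exact absurd (h1.symm.trans hw.symm) huv
        · exact absurd (hw.trans h2) huv
        · exact ⟨hw, h1⟩
      have hx := key x hf.2.1
      have hz := key z hf.2.2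
      have := huniq _ ((mkEdge_mem_insideFixed hxz).2 ⟨hf.1, hx.1, hz.1⟩)
      rw [mkEdge_eq_iff] at this
      rcases this with h | h
      · exact hx.2 h.1
      · exact hz.2 h.2

theorem MatchingPhase.bipartitionPhase {A E : Finset (Edges n)} (hd : Disjoint A E)
    (hAE : A.card = E.card) (h : MatchingPhase 1 A E) (hcard : n < 2 * A.card + 3) :
    BipartitionPhase A E := by
  obtain ⟨p, hp, hA, hfix, hE⟩ := h
  -- At most two vertices are unmatched. If there are two, `q` pairs them as well, to make the
  -- bipartition balanced; an Enforcer edge joining them is left out of the averaging.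
  obtain ⟨q, hq, hqfix, hqp⟩ : ∃ q : Fin n → Fin n, Function.Involutive q ∧
      (Finset.univ.filter fun x => q x = x).card ≤ 1 ∧ ∀ x, p x ≠ x → q x = p x := by
    by_cases h2 : 1 < (Finset.univ.filter fun x => p x = x).card
    · obtain ⟨u, hu, v, hv, huv⟩ := Finset.one_lt_card.1 h2
      simp only [Finset.mem_filter, Finset.mem_univ, true_and] at hu hv
      refine ⟨pairUp p u v, pairUp_involutive hp hu hv, ?_, fun x hx => ?_⟩
      · have := card_fixed_pairUp huv hu hv
        omega
      · unfold pairUp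
        rw [if_neg (by rintro rfl; exact hx hu), if_neg (by rintro rfl; exact hx hv)]
    · exact ⟨p, hp, by omega, fun _ _ => rfl⟩
  obtain ⟨c, hc, hhalf⟩ := exists_alternating_half hq (E \ insideFixed p E) (by
    intro x y hxy hmem hqx
    rw [Finset.mem_sdiff, mkEdge_mem_insideFixed] at hmem
    have hnA : mkEdge x y hxy ∉ A := fun h => Finset.disjoint_left.1 hd h hmem.1
    by_cases hx : p x = x
    · have hy : p y ≠ y := fun hy => hmem.2 ⟨hmem.1, hx, hy⟩
      have := hqp y hy
      rw [← hqx, hq] at this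
      rw [mkEdge_comm, hA, ← hqx, ← this] at hnA
      exact hnA rfl
    · rw [hA, ← hqp x hx] at hnA
      exact hnA hqx)
  refine ⟨c, mem_properColorings_of_alternating (p := q) ?_ hc,
    sq_div_four_le_card_bichrom hq hqfix hc, ?_⟩
  · intro x y hxy hmem
    rw [hA] at hmem
    rw [hqp x (by rw [hmem]; exact hxy.symm), hmem]
  -- Enforcer has at least `(n - 1) / 2` edges. Dropping one of them costs nothing: half of `m - 1`,
  -- rounded up, is `m / 2` rounded down.
  · have h1 := Finset.le_card_sdiff (insideFixed p E) E
    have h2 : ((E \ insideFixed p E).filter fun e => ¬ Bichrom c e).card ≤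
        (E.filter fun e => ¬ Bichrom c e).card :=
      Finset.card_le_card (Finset.filter_subset_filter _ Finset.sdiff_subset)
    omega

theorem BipartitionPhase.step {A E : Finset (Edges n)} (hAE : A.card = E.card) (h : BipartitionPhase A E)
    (hlt : 2 * A.card < n ^ 2 / 4 + (n - 1) / 4) :
    ∃ v, v ∉ A ∪ E ∧ BipartitionPhase (insert v A) E := by
  obtain ⟨c, hc, hbal, hw⟩ := h
  have h1 := Finset.card_filter_add_card_filter_not (s := E) (Bichrom c)
  have h2 := Finset.card_union_le A (E.filter (Bichrom c))
  -- Enforcer's monochromatic edges take nothing from the cut, so the cut is not yet exhausted.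
  obtain ⟨v, hv⟩ : ((Finset.univ.filter (Bichrom c)) \ (A ∪ E.filter (Bichrom c))).Nonempty := by
    rw [← Finset.card_pos]
    have := Finset.le_card_sdiff (A ∪ E.filter (Bichrom c)) (Finset.univ.filter (Bichrom c))
    omega
  simp only [Finset.mem_sdiff, Finset.mem_filter, Finset.mem_univ, true_and, Finset.mem_union,
    not_or, not_and] at hv
  refine ⟨v, ?_, c, ?_, hbal, hw⟩
  · simp only [Finset.mem_union, not_or]
    exact ⟨hv.2.1, fun h => hv.2.2 h hv.1⟩
  · simp only [mem_properColorings, Finset.mem_insert, forall_eq_or_imp] at hc ⊢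
    exact ⟨hv.1, hc⟩

theorem avoiderSurvives_general (n : ℕ) :
    AvoiderSurvives (NC2 n) ((n ^ 2 / 4 + (n - 1) / 4 + 1) / 2) := by
  refine avoiderSurvives_of_invariant
    (fun A E => MatchingPhase 1 A E ∨ BipartitionPhase A E)
    (fun A E => MatchingPhase 0 A E ∨ BipartitionPhase A E) ?_ ?_ ?_ ?_ ?_
  · refine Or.inl ⟨id, fun _ => rfl, ?_, by simp, by simp [insideFixed]⟩
    intro x y h
    simpa using h
  · intro A E hd hAE ht hP _
    have key : BipartitionPhase A E → ∃ v, v ∉ A ∪ E ∧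
        (MatchingPhase 0 (insert v A) E ∨ BipartitionPhase (insert v A) E) := fun h => by
      obtain ⟨v, hv, hB⟩ := h.step hAE (by omega)
      exact ⟨v, hv, Or.inr hB⟩
    rcases hP with h | h
    · by_cases hcard : 2 * A.card + 3 ≤ n
      · obtain ⟨v, hv, hB⟩ := h.step hcard
        exact ⟨v, hv, Or.inl hB⟩
      · exact key (h.bipartitionPhase hd hAE (by omega))
    · exact key h
  · intro A E _ _ _ hQ v _
    rcases hQ with ⟨p, hp, hA, hfix, hE⟩ | ⟨c, hc, hbal, hw⟩
    · refine Or.inl ⟨p, hp, hA, hfix, ?_⟩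
      have hsub : insideFixed p (insert v E) ⊆ insert v (insideFixed p E) := by
        intro e he
        simp only [insideFixed, Finset.mem_filter, Finset.mem_insert] at he ⊢
        tauto
      have h1 := Finset.card_le_card hsub
      have h2 := Finset.card_insert_le v (insideFixed p E)
      omega
    · refine Or.inr ⟨c, hc, hbal, hw.trans (Finset.card_le_card ?_)⟩
      exact Finset.filter_subset_filter _ (Finset.subset_insert _ _)
  · rintro A E (h | ⟨c, hc, -⟩)
    · exact not_exists_subset h.properColorings_nonempty
    · exact not_exists_subset ⟨c, hc⟩
  · rintro A E (h | ⟨c, hc, -⟩)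
    · exact not_exists_subset h.properColorings_nonempty
    · exact not_exists_subset ⟨c, hc⟩

end Avoider

/-! ### The boards K_4 and K_5 -/

section SmallBoards

/-- Two edges of K_4 can be completed to a triangle by at most one further edge, so of two free
edges one is safe. -/
theorem exists_bichrom_of_four : ∀ a b e f : Edges 4, e ≠ f → e ≠ a → e ≠ b → f ≠ a → f ≠ b →
    ∃ c : Fin 4 → Bool, Bichrom c a ∧ Bichrom c b ∧ (Bichrom c e ∨ Bichrom c f) := by
  decide +kernel

theorem avoiderSurvives_four : AvoiderSurvives (NC2 4) 3 := by
  refine avoiderSurvives_of_invariant (fun A _ => (properColorings A).Nonempty)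
    (fun A _ => (properColorings A).Nonempty) ?_ ?_ ?_ ?_ ?_
  · exact ⟨fun _ => true, by simp⟩
  · intro A E hd hAE ht _ _
    obtain ⟨e, he, f, hf, hef⟩ : ∃ e ∈ Finset.univ \ (A ∪ E), ∃ f ∈ Finset.univ \ (A ∪ E), e ≠ f := by
      rw [← Finset.one_lt_card]
      have h1 := Finset.le_card_sdiff (A ∪ E) (Finset.univ : Finset (Edges 4))
      have h2 := Finset.card_union_le A E
      rw [Finset.card_univ, card_edges] at h1
      omega
    simp only [Finset.mem_sdiff, Finset.mem_univ, true_and] at he hf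
    obtain ⟨a, b, hab⟩ : ∃ a b, A ⊆ {a, b} ∧ (A.Nonempty → a ∈ A ∧ b ∈ A) := by
      have : A.card = 0 ∨ A.card = 1 ∨ A.card = 2 := by omega
      rcases this with h | h | h
      · rw [Finset.card_eq_zero] at h
        exact ⟨e, e, by simp [h], by simp [h]⟩
      · obtain ⟨a, rfl⟩ := Finset.card_eq_one.1 h
        exact ⟨a, a, by simp, by simp⟩
      · obtain ⟨a, b, -, rfl⟩ := Finset.card_eq_two.1 h
        exact ⟨a, b, subset_rfl, by simp⟩
    have hne : ∀ g h : Edges 4, g ∉ A ∪ E → h ∈ A → g ≠ h := by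
      rintro g h hg hh rfl
      exact hg (Finset.mem_union_left _ hh)
    rcases A.eq_empty_or_nonempty with h0 | h0
    · refine ⟨e, he, ?_⟩
      obtain ⟨x, y, hxy, rfl⟩ := exists_eq_mkEdge e
      exact ⟨fun v => decide (v = x), by simp [h0, hxy.symm]⟩
    · obtain ⟨c, hca, hcb, hc⟩ := exists_bichrom_of_four a b e f hef (hne e a he (hab.2 h0).1)
        (hne e b he (hab.2 h0).2) (hne f a hf (hab.2 h0).1) (hne f b hf (hab.2 h0).2)
      have hA : ∀ g ∈ A, Bichrom c g := by
        intro g hg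
        rcases Finset.mem_insert.1 (hab.1 hg) with rfl | h
        · exact hca
        · rwa [Finset.mem_singleton.1 h]
      rcases hc with hc | hc
      · exact ⟨e, he, c, by simpa [hc] using hA⟩
      · exact ⟨f, hf, c, by simpa [hc] using hA⟩
  · intro A E _ _ _ h v _
    exact h
  · intro A E h
    exact not_exists_subset h
  · intro A E h
    exact not_exists_subset h

/-- An injective labelling of the edges of `K_5`, used as bit positions in masks. -/
def label (e : Edges 5) : ℕ :=
  Sym2.lift ⟨fun i j => ![0, 1, 2, 4, 7] i + ![0, 1, 2, 4, 7] j, fun _ _ => add_comm _ _⟩ e.1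

/-- The vertex weights 0, 1, 2, 4, 7 have distinct pairwise sums. -/
theorem label_injective : Function.Injective label := by
  unfold Function.Injective
  decide +kernel

/-- The labels of the edges of `K_5`. -/
def labels : List ℕ := [1, 2, 3, 4, 5, 6, 7, 8, 9, 11]

theorem label_mem (e : Edges 5) : label e ∈ labels := by
  revert e
  decide +kernel

theorem exists_label {i : ℕ} (h : i ∈ labels) : ∃ e, label e = i := by
  revert i
  decide +kernel

/-- The edge sets of the complements of the cuts of `K_5`, as masks. -/
def cocuts : List ℕ :=
  [3070, 2920, 2772, 2626, 2482, 2340, 2200, 2062, 910, 792, 676, 562, 450, 340, 232, 126]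

/-- Only this direction is needed: a graph meeting every mask in `cocuts` has a monochromatic edge
in each colouring. -/
theorem exists_cocut : ∀ c : Fin 5 → Bool, ∃ m ∈ cocuts, m < 2 ^ 12 ∧
    ∀ i < 12, m.testBit i → ∃ e, label e = i ∧ ¬ Bichrom c e := by
  decide +kernel

/-- The graph with edge mask `a` has an odd cycle. -/
def hasOddCycle (a : ℕ) : Bool := cocuts.all fun m => a &&& m != 0

/-- Enforcer, to answer Avoider's next move at the position `(a, e)`, has a win in `k` rounds. -/
def enforcerWinsMask : ℕ → ℕ → ℕ → Bool
  | 0, a, _ => hasOddCycle a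
  | k + 1, a, e => labels.all fun v => (a ||| e).testBit v || hasOddCycle (a ||| 1 <<< v) ||
      labels.any fun w => !(a ||| 1 <<< v ||| e).testBit w &&
        enforcerWinsMask k (a ||| 1 <<< v) (e ||| 1 <<< w)

/-- An exhaustive game-tree search evaluated by the kernel; the bit masks keep it feasible. -/
theorem enforcerWinsMask_five : enforcerWinsMask 5 0 0 = true := by
  decide +kernel

/-- `a` is the mask of the edge set `A`. -/
def IsMask (A : Finset (Edges 5)) (a : ℕ) : Prop := ∀ e, e ∈ A ↔ a.testBit (label e) = true

theorem IsMask.insert {A : Finset (Edges 5)} {a : ℕ} (h : IsMask A a) (v : Edges 5) :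
    IsMask (insert v A) (a ||| 1 <<< label v) := by
  intro e
  have h1 : e = v ↔ label v = label e := ⟨fun h => by rw [h], fun h => (label_injective h).symm⟩
  rw [Finset.mem_insert, h e, Nat.testBit_or, Nat.one_shiftLeft, Nat.testBit_two_pow, h1]
  simp [or_comm]

theorem IsMask.mem_union {A E : Finset (Edges 5)} {a e : ℕ} (h : IsMask A a) (h' : IsMask E e)
    (v : Edges 5) : v ∈ A ∪ E ↔ (a ||| e).testBit (label v) = true := by
  rw [Finset.mem_union, h, h', Nat.testBit_or]
  simp

theorem IsMask.not_nonempty {A : Finset (Edges 5)} {a : ℕ} (h : IsMask A a)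
    (ha : hasOddCycle a = true) : ¬ (properColorings A).Nonempty := by
  rintro ⟨c, hc⟩
  obtain ⟨m, hm, hlt, hbit⟩ := exists_cocut c
  have h1 := List.all_eq_true.1 ha m hm
  simp only [bne_iff_ne, ne_eq] at h1
  refine h1 (Nat.eq_of_testBit_eq fun i => ?_)
  rw [Nat.testBit_and, Nat.zero_testBit, Bool.and_eq_false_iff]
  by_contra! hcon
  simp only [ne_eq, Bool.not_eq_false] at hcon
  have hi : i < 12 := by
    by_contra! hi
    rw [Nat.testBit_lt_two_pow (hlt.trans_le (Nat.pow_le_pow_right (by norm_num) hi))] at hcon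
    simp at hcon
  obtain ⟨e, rfl, he⟩ := hbit i hi hcon.2
  exact he (mem_properColorings.1 hc e ((h e).2 hcon.1))

theorem enforcerWinsWithin_five : EnforcerWinsWithin (NC2 5) 5 := by
  refine enforcerWinsWithin_of_invariant
    (fun A E => (properColorings A).Nonempty →
      ∃ a e, IsMask A a ∧ IsMask E e ∧ enforcerWinsMask (5 - A.card) a e = true)
    (fun A E => (properColorings A).Nonempty →
      ∃ a e, IsMask A a ∧ IsMask E e ∧ labels.any (fun w => !(a ||| e).testBit w &&
        enforcerWinsMask (5 - A.card) a (e ||| 1 <<< w)) = true) ?_ ?_ ?_ ?_ ?_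
  · intro _
    exact ⟨0, 0, by simp [IsMask], by simp [IsMask], enforcerWinsMask_five⟩
  · intro A E _ hAE ht hP v hv hne
    have hsub : properColorings (insert v A) ⊆ properColorings A := by
      intro b hb
      simp only [mem_properColorings, Finset.mem_insert, forall_eq_or_imp] at hb ⊢
      exact hb.2
    obtain ⟨a, e, ha, he, hw⟩ := hP (hne.mono hsub)
    refine ⟨a ||| 1 <<< label v, e, ha.insert v, he, ?_⟩
    rw [Finset.card_insert_of_notMem fun h => hv (Finset.mem_union_left _ h)]
    obtain ⟨k, hk⟩ : ∃ k, 5 - A.card = k + 1 := ⟨4 - A.card, by omega⟩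
    rw [hk, enforcerWinsMask] at hw
    have h1 := List.all_eq_true.1 hw (label v) (label_mem v)
    rw [ha.mem_union he] at hv
    have h2 : ¬ hasOddCycle (a ||| 1 <<< label v) = true := fun h =>
      (ha.insert v).not_nonempty h hne
    rw [show 5 - (A.card + 1) = k by omega]
    simpa [hv, h2] using h1
  · intro A E _ _ _ hQ hv
    by_cases hne : (properColorings A).Nonempty
    · obtain ⟨a, e, ha, he, hw⟩ := hQ hne
      obtain ⟨i, hi, hw⟩ := List.any_eq_true.1 hw
      obtain ⟨w, rfl⟩ := exists_label hi
      simp only [Bool.and_eq_true, Bool.not_eq_true'] at hw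
      refine ⟨w, ?_, fun _ => ⟨a, _, ha, he.insert w, hw.2⟩⟩
      rw [ha.mem_union he, hw.1]
      simp
    · obtain ⟨v, hv⟩ := hv
      exact ⟨v, hv, fun h => absurd h hne⟩
  · intro A E hd hAE hP ht
    rw [exists_subset_iff]
    intro hne
    have hA : A.card = 5 := by
      rcases ht with ht | ht
      · exact ht
      · have := Finset.card_union_of_disjoint hd
        rw [Finset.eq_univ_iff_forall.2 ht, Finset.card_univ, card_edges] at this
        omega
    obtain ⟨a, e, ha, he, hw⟩ := hP hne
    rw [hA] at hw
    exact ha.not_nonempty hw hne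
  · intro A E hd hAE _ ht
    have := Finset.card_union_of_disjoint hd
    rw [Finset.eq_univ_iff_forall.2 ht, Finset.card_univ, card_edges] at this
    omega

end SmallBoards

end AvoiderEnforcer

/-! ### The numerical bounds -/

open AvoiderEnforcer in
theorem exists_enforcerWinsWithin (n : ℕ) (hn : 5 ≤ n) : ∃ t : ℕ,
    (t : ℝ) ≤ (n : ℝ) ^ 2 / 8 + (n : ℝ) / 2 + 1 ∧ EnforcerWinsWithin (NC2 n) t := by
  rcases hn.eq_or_lt with rfl | hn
  · exact ⟨5, by norm_num, enforcerWinsWithin_five⟩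
  · refine ⟨_, ?_, enforcerWinsWithin_of_six_le hn⟩
    have h1 : 8 * ((n ^ 2 / 4 + (n - 1)) / 2 + 1) ≤ n ^ 2 + 4 * n + 8 := by omega
    have h2 : (8 : ℝ) * (((n ^ 2 / 4 + (n - 1)) / 2 + 1 : ℕ) : ℝ) ≤ (n : ℝ) ^ 2 + 4 * n + 8 := by
      exact_mod_cast h1
    linarith

open AvoiderEnforcer in
theorem theorem2 :
    (∃ c C : ℝ, 0 < c ∧ 0 < C ∧ ∀ᶠ n : ℕ in Filter.atTop, ∃ t : ℕ,
      AvoiderEnforcer.tauE (AvoiderEnforcer.NC2 n) = (t : ℕ∞) ∧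
      (n : ℝ) ^ 2 / 8 + c * (n : ℝ) ≤ (t : ℝ) ∧ (t : ℝ) ≤ (n : ℝ) ^ 2 / 8 + C * (n : ℝ)) ∧
    (∀ n : ℕ, 5 ≤ n → ∃ t : ℕ,
      (t : ℝ) ≤ (n : ℝ) ^ 2 / 8 + (n : ℝ) / 2 + 1 ∧
      AvoiderEnforcer.EnforcerWinsWithin (AvoiderEnforcer.NC2 n) t) ∧
    (∀ n : ℕ, Even n → ∃ t : ℕ,
      (n : ℝ) ^ 2 / 8 + ((n : ℝ) - 2) / 12 ≤ (t : ℝ) ∧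
      AvoiderEnforcer.AvoiderSurvives (AvoiderEnforcer.NC2 n) t) := by
  -- Avoider's bound has linear term about `n / 8` and Enforcer's has `n / 2 + 1`; the constants
  -- leave room for rounding.
  refine ⟨⟨1 / 16, 2, by norm_num, by norm_num, ?_⟩, exists_enforcerWinsWithin, ?_⟩
  · filter_upwards [Filter.eventually_ge_atTop 20] with n hn
    obtain ⟨t, ht, hwin⟩ := exists_enforcerWinsWithin n (by omega)
    obtain ⟨k, hk, hlt, hle⟩ := exists_tauE_eq (avoiderSurvives_general n) hwin
    refine ⟨k, hk, ?_, ?_⟩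
    · have h1 : 2 * n ^ 2 + n ≤ 16 * k := by omega
      have h2 : 2 * (n : ℝ) ^ 2 + n ≤ 16 * k := by exact_mod_cast h1
      linarith
    · have h1 : (k : ℝ) ≤ t := by exact_mod_cast hle
      have h2 : (20 : ℝ) ≤ n := by exact_mod_cast hn
      linarith
  · rintro n ⟨j, rfl⟩
    -- For `n = 4` the general bound gives 2 rounds, while 2 + 1/6 are required.
    by_cases hj : j = 2
    · subst hj
      exact ⟨3, by norm_num, avoiderSurvives_four⟩
    · refine ⟨_, ?_, avoiderSurvives_general (j + j)⟩
      have h0 : (j + j) ^ 2 / 4 = j ^ 2 := by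
        rw [show (j + j) ^ 2 = j ^ 2 * 4 by ring, Nat.mul_div_cancel _ (by norm_num)]
      rw [h0]
      have h1 : 3 * j ^ 2 + j ≤ 6 * ((j ^ 2 + (j + j - 1) / 4 + 1) / 2) + 1 := by omega
      have h2 : 3 * (j : ℝ) ^ 2 + j ≤ 6 * (((j ^ 2 + (j + j - 1) / 4 + 1) / 2 : ℕ) : ℝ) + 1 := by
        exact_mod_cast h1
      push_cast
      linarith
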